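/- For $G_0\subset\mathbb Z$, a sequence over $G_0$ is a finite multiset $S$ of elements of $G_0$, with length $|S|$, support $\operatorname{supp}(S)$ (the set of its terms) and multiplicities $\mathsf v_x(S)$; $S^+$ and $S^-$ denote the subsequences of all positive, respectively negative, terms of $S$. Let $\mathcal B(G_0)$ be the monoid, under concatenation, of all sequences over $G_0$ whose terms sum to $0$. An atom is a nonempty $U\in\mathcal B(G_0)$ that is not the product of two nonempty elements of $\mathcal B(G_0)$. For $B\in\mathcal B(G_0)$, let $\mathsf Z(B)$ be the set of factorizations of $B$, i.e. of finite multisets $z$ of atoms with product $B$; let $|z|$ be the number of atoms in $z$, counted with multiplicity, and $\mathsf L(B)=\{|z| : z\in\mathsf Z(B)\}$. For $z,z'\in\mathsf Z(B)$, let $\mathsf d(z,z')=\max\{|z|,|z'|\}-|\gcd(z,z')|$, where $\gcd(z,z')$ is the multiset intersection of $z$ and $z'$. The set $G_0$ is condensed if every $g\in G_0$ occurs in some $B\in\mathcal B(G_0)$. For $A\subset\mathbb Z$, $\langle A\rangle$ is the subgroup of $\mathbb Z$ generated by $A$. Let $G_0\subset\mathbb Z\setminus\{0\}$ be a condensed set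 with $|G_0|\ge 2$. Let $B\in\mathcal B(G_0)$ be nonempty and such that, for $M=|\min(\operatorname{supp}(B))|$, we have $M\ge 2$ and $\min(\operatorname{supp}(B^+))\ge M(M^2-1)$. Then at least one of the following statements holds: (a) There exist a subset $A\subset\operatorname{supp}(B^-)$ and a factorization $z\in\mathsf Z(B)$ such that $\langle\operatorname{supp}(B^+)\rangle\not\subset\langle A\rangle$ (in particular, $\langle A\rangle\ne\mathbb Z$) and every atom $U$ occurring in $z$ satisfies $\mathsf v_x(U)\le 2M-2$ for all $x\in\operatorname{supp}(B)\setminus A$. (b) (i) $\max\mathsf L(B)=|B^+|$, and (ii) for every factorization $z\in\mathsf Z(B)$ there exist $r\ge 0$ and a chain of factorizations $z=z_0,\ldots,z_r$ of $B$ such that $|z|=|z_0|<\cdots<|z_r|=|B^+|$ and $\mathsf d(z_i,z_{i+1})\le M^2$ for all $i\in[0,r-1]$. -/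

import Mathlib

/-- The monoid of zero-sum sequences over a subset `G₀` of an abelian group `G`, written
additively. A sequence over `G₀` is a finite multiset of elements of `G₀`. -/
def zeroSumMonoid {G : Type*} [AddCommGroup G] (G₀ : Set G) : AddSubmonoid (Multiset G) where
  carrier := {S | (∀ g ∈ S, g ∈ G₀) ∧ S.sum = 0}
  zero_mem' := by simp
  add_mem' := by
    rintro S T ⟨hS, hS0⟩ ⟨hT, hT0⟩
    refine ⟨fun g hg => ?_, by simp [hS0, hT0]⟩
    rcases Multiset.mem_add.1 hg with h | h
    · exact hS g h
    · exact hT g h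

/-- `G₀` is condensed: every element of `G₀` occurs in some zero-sum sequence over `G₀`. -/
def IsCondensed {G : Type*} [AddCommGroup G] (G₀ : Set G) : Prop :=
  ∀ g ∈ G₀, ∃ B ∈ zeroSumMonoid G₀, g ∈ B

/-- The subsequence `S⁺` of all positive terms of `S`, with their multiplicities. -/
def posTerms (S : Multiset ℤ) : Multiset ℤ := S.filter fun x => 0 < x

/-- The subsequence `S⁻` of all negative terms of `S`, with their multiplicities. -/
def negTerms (S : Multiset ℤ) : Multiset ℤ := S.filter fun x => x < 0

section Factorizations

variable {H : Type*} [AddCommMonoid H]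

/-- The set `Z(a)` of factorizations of an element `a` of a monoid `H`, written additively, whose
only unit is `0` (as is the case for `zeroSumMonoid G₀`): finite multisets of atoms of `H`
with sum `a`. The length of a factorization is its cardinality. -/
def factorizations (a : H) : Set (Multiset H) :=
  {z | (∀ u ∈ z, AddIrreducible u) ∧ z.sum = a}

/-- The set of lengths `L(a)`. -/
def lengthSet (a : H) : Set ℕ := Multiset.card '' factorizations a

/-- The distance `d(z, z') = max {|z gcd(z, z')⁻¹|, |z' gcd(z, z')⁻¹|}` of factorizations. -/
def factorizationDist [DecidableEq H] (z z' : Multiset H) : ℕ :=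
  max (z - z ∩ z').card (z' - z ∩ z').card

end Factorizations

/-! ### Subsums modulo an integer -/

/-! Every atom over nonzero integers contains a positive term, so no factorization of `B` has more
than `|B⁺|` atoms. If (a) fails, every factorization `z` with `|z| < |B⁺|` can be lengthened by a
step of distance at most `M ^ 2`; iterating gives (b).

To lengthen `z`, let `A` be the set of negative terms that occur at least `2M - 1` times in some
atom of `z`. Positive terms occur at most `M ≤ 2M - 2` times in an atom
(`card_posTerms_le_of_addIrreducible`), so the failure of (a) forces all positive terms of `B` into
`⟨A⟩`. Some atom `U` of `z` has at least two positive terms. Fix one of them, `u`; the aim is to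
find negative terms with sum `-u`, so that `U` splits in two.

Since positive terms are large, `U` has many negative terms, and one value `-y` occurs at least `2M
- 2` times. Modulo `y`, fewer than `y` elements of `A` have subsums covering `⟨A⟩`
(`exists_multiset_subsums_cover`); these correct the residue of `u`, and copies of `-y` correct the
size (`exists_le_sum_eq_neg`). Elements of `A` that `U` lacks are borrowed from atoms rich in them,
in exchange for negative terms of `U` with the same sum (`exists_exchange`). This involves at most
`M` atoms, each with at most `M` positive terms, whence the bound `M ^ 2`. -/

theorem Multiset.exists_le_card_le_dvd_sum {n : ℕ} (hn : 0 < n) {N : Multiset ℤ}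
    (hN : n ≤ N.card) : ∃ T ≤ N, T ≠ 0 ∧ T.card ≤ n ∧ (n : ℤ) ∣ T.sum := by
  have : NeZero n := ⟨hn.ne'⟩
  obtain ⟨l, rfl⟩ := Quot.exists_rep N
  change n ≤ l.length at hN
  -- Two of the `n + 1` prefix sums agree modulo `n`; the block between them is the required
  -- subsequence.
  have key : ∃ i j : ℕ, i < j ∧ j ≤ n ∧ (n : ℤ) ∣ (l.take j).sum - (l.take i).sum := by
    have hlt : (Finset.univ : Finset (ZMod n)).card < (Finset.range (n + 1)).card := by
      simp [ZMod.card]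
    obtain ⟨i, hi, j, hj, hij, he⟩ := Finset.exists_ne_map_eq_of_card_lt_of_maps_to hlt
      (f := fun i => (((l.take i).sum : ℤ) : ZMod n)) (fun _ _ => Finset.mem_coe.2 (Finset.mem_univ _))
    rw [Finset.mem_range] at hi hj
    rcases lt_or_gt_of_ne hij with h | h
    · exact ⟨i, j, h, by omega, (ZMod.intCast_eq_intCast_iff_dvd_sub _ _ _).1 he⟩
    · exact ⟨j, i, h, by omega, (ZMod.intCast_eq_intCast_iff_dvd_sub _ _ _).1 he.symm⟩
  obtain ⟨i, j, hij, hj, hd⟩ := key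
  have hsum : ((l.take j).drop i).sum = (l.take j).sum - (l.take i).sum := by
    have := congrArg List.sum (List.take_append_drop i (l.take j))
    rw [List.sum_append, List.take_take, min_eq_left hij.le] at this
    linarith
  have hlen : ((l.take j).drop i).length = j - i := by
    simp only [List.length_drop, List.length_take]; omega
  refine ⟨((l.take j).drop i : List ℤ), ?_, ?_, ?_, ?_⟩
  · exact Multiset.coe_le.2 ((List.drop_sublist _ _).trans (List.take_sublist _ _)).subperm
  · rw [Ne, ← Multiset.card_eq_zero, Multiset.coe_card, hlen]; omega
  · rw [Multiset.coe_card, hlen]; omega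
  · rw [Multiset.sum_coe, hsum]; exact hd

/-- The residues modulo `n` of the sums of all subsequences of `X`. -/
def subsumResidues (n : ℕ) (X : Multiset ℤ) : Finset (ZMod n) :=
  (X.powerset.map fun T => ((T.sum : ℤ) : ZMod n)).toFinset

theorem mem_subsumResidues {n : ℕ} {X : Multiset ℤ} {a : ZMod n} :
    a ∈ subsumResidues n X ↔ ∃ T ≤ X, ((T.sum : ℤ) : ZMod n) = a := by
  simp [subsumResidues]

theorem subsumResidues_subset_cons (n : ℕ) (X : Multiset ℤ) (x : ℤ) :
    subsumResidues n X ⊆ subsumResidues n (x ::ₘ X) := by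
  intro a ha
  obtain ⟨T, hT, rfl⟩ := mem_subsumResidues.1 ha
  exact mem_subsumResidues.2 ⟨T, hT.trans (Multiset.le_cons_self _ _), rfl⟩

theorem add_mem_subsumResidues_cons {n : ℕ} {X : Multiset ℤ} {x : ℤ} {a : ZMod n}
    (ha : a ∈ subsumResidues n X) : a + x ∈ subsumResidues n (x ::ₘ X) := by
  obtain ⟨T, hT, rfl⟩ := mem_subsumResidues.1 ha
  refine mem_subsumResidues.2 ⟨x ::ₘ T, Multiset.cons_le_cons _ hT, ?_⟩
  simp [add_comm]

theorem subsumResidues_cons_of_dvd {n : ℕ} {X : Multiset ℤ} {x : ℤ} (hx : (n : ℤ) ∣ x) :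
    subsumResidues n (x ::ₘ X) ⊆ subsumResidues n X := by
  intro a ha
  obtain ⟨T, hT, rfl⟩ := mem_subsumResidues.1 ha
  have hx0 : ((x : ℤ) : ZMod n) = 0 := (ZMod.intCast_zmod_eq_zero_iff_dvd x n).2 hx
  by_cases hxT : x ∈ T
  · obtain ⟨T', rfl⟩ := Multiset.exists_cons_of_mem hxT
    exact mem_subsumResidues.2 ⟨T', (Multiset.cons_le_cons_iff x).1 hT, by simp [hx0]⟩
  · exact mem_subsumResidues.2 ⟨T, (Multiset.le_cons_of_notMem hxT).1 hT, rfl⟩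

/-- Every subgroup of `ℤ` is covered modulo `n` by the subsums of fewer than `n` generators. -/
theorem exists_multiset_subsums_cover {n : ℕ} (hn : 0 < n) (A : Set ℤ) :
    ∃ X : Multiset ℤ, (∀ x ∈ X, x ∈ A ∧ ¬ (n : ℤ) ∣ x) ∧ X.card + 1 ≤ n ∧
      ∀ g ∈ AddSubgroup.closure A, ∃ T ≤ X, (n : ℤ) ∣ g - T.sum := by
  have : NeZero n := ⟨hn.ne'⟩
  -- A largest `X` for which each term contributes at least one new residue. As there are only `n`
  -- residues, `X` has fewer than `n` terms.
  let P : ℕ → Prop := fun k => ∃ X : Multiset ℤ, (∀ x ∈ X, x ∈ A ∧ ¬ (n : ℤ) ∣ x) ∧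
    X.card + 1 ≤ (subsumResidues n X).card ∧ X.card = k
  have hle : ∀ X, (subsumResidues n X).card ≤ n := fun X => by
    simpa [ZMod.card] using Finset.card_le_univ (subsumResidues n X)
  have hP0 : P 0 := by
    refine ⟨0, by simp, ?_, rfl⟩
    have : (0 : ZMod n) ∈ subsumResidues n 0 := mem_subsumResidues.2 ⟨0, le_rfl, by simp⟩
    simpa using Finset.card_pos.2 ⟨_, this⟩
  classical
  obtain ⟨X, hXA, hXc, hXk⟩ := Nat.findGreatest_spec (P := P) (Nat.zero_le n) hP0
  refine ⟨X, hXA, hXc.trans (hle X), ?_⟩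
  have hmax : ∀ x ∈ A, subsumResidues n (x ::ₘ X) ⊆ subsumResidues n X := by
    intro x hx
    by_cases hdx : (n : ℤ) ∣ x
    · exact subsumResidues_cons_of_dvd hdx
    by_contra hne
    have hlt : (subsumResidues n X).card < (subsumResidues n (x ::ₘ X)).card :=
      Finset.card_lt_card ⟨subsumResidues_subset_cons n X x, hne⟩
    have hP : P (X.card + 1) := by
      refine ⟨x ::ₘ X, ?_, by rw [Multiset.card_cons]; omega, by simp⟩
      intro w hw
      rcases Multiset.mem_cons.1 hw with rfl | hw
      · exact ⟨hx, hdx⟩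
      · exact hXA w hw
    have := Nat.le_findGreatest (P := P) (hXc.trans (hle X)) hP
    omega
  have hclosed : ∀ g ∈ AddSubgroup.closure A, ∀ s ∈ subsumResidues n X,
      s + ((g : ℤ) : ZMod n) ∈ subsumResidues n X := by
    intro g hg
    induction hg using AddSubgroup.closure_induction with
    | mem x hx => exact fun s hs => hmax x hx (add_mem_subsumResidues_cons hs)
    | zero => simp
    | add x y _ _ hx hy =>
      intro s hs
      rw [Int.cast_add, ← add_assoc]
      exact hy _ (hx s hs)
    | neg x _ hx =>
      intro s hs
      -- Translation by `x` is an injection of a finite set into itself, hence surjective, so the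
      -- set is also stable under translation by `-x`.
      obtain ⟨t, ht, hts⟩ := Finset.surj_on_of_inj_on_of_card_le
        (s := subsumResidues n X) (t := subsumResidues n X)
        (fun a _ => a + ((x : ℤ) : ZMod n)) (fun a ha => hx a ha)
        (fun a b _ _ hab => add_right_cancel hab) le_rfl s hs
      rw [hts]
      simpa using ht
  intro g hg
  have h0 : (0 : ZMod n) ∈ subsumResidues n X := mem_subsumResidues.2 ⟨0, by simp, by simp⟩
  obtain ⟨T, hT, hTg⟩ := mem_subsumResidues.1 (hclosed g hg 0 h0)
  rw [zero_add] at hTg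
  exact ⟨T, hT, (ZMod.intCast_eq_intCast_iff_dvd_sub _ _ _).1 hTg⟩

/-! ### Splitting and exchanging negative terms -/

theorem Multiset.neg_mul_card_le_sum {M : ℤ} {N : Multiset ℤ} (h : ∀ a ∈ N, -M ≤ a) :
    -(M * N.card) ≤ N.sum := by
  have := Multiset.card_nsmul_le_sum h
  rw [nsmul_eq_mul] at this
  linarith

theorem Multiset.sum_nonpos_of_forall_neg {N : Multiset ℤ} (h : ∀ a ∈ N, a < 0) :
    N.sum ≤ 0 := by
  have := Multiset.sum_le_card_nsmul N 0 (fun a ha => (h a ha).le)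
  simpa using this

/-- A subsequence of `X` fixes the residue of `u` modulo `y`, a greedy part of `R` with sum
divisible by `y` brings the remainder down, and copies of `-y` finish exactly. -/
theorem exists_le_sum_eq_neg {M y : ℕ} (hy : 0 < y) (hyM : y ≤ M) {X R : Multiset ℤ}
    (hX : ∀ a ∈ X, -(M : ℤ) ≤ a ∧ a < 0) (hR : ∀ a ∈ R, -(M : ℤ) ≤ a ∧ a < 0)
    (hXc : X.card + 1 ≤ y) {u v : ℤ} (hu : (M : ℤ) * ((M : ℤ) ^ 2 - 1) ≤ u)
    (hv : (M : ℤ) * ((M : ℤ) ^ 2 - 1) ≤ v)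
    (hcov : ∃ T ≤ X, (y : ℤ) ∣ u + T.sum)
    (hsum : (X + Multiset.replicate (2 * M - 2) (-(y : ℤ)) + R).sum = -(u + v)) :
    ∃ T ≤ X + Multiset.replicate (2 * M - 2) (-(y : ℤ)) + R, T.sum = -u := by
  have hy1 : (1 : ℤ) ≤ y := by exact_mod_cast hy
  have hyM' : (y : ℤ) ≤ M := by exact_mod_cast hyM
  have hXc' : (X.card : ℤ) + 1 ≤ y := by exact_mod_cast hXc
  have hXs : -((M : ℤ) * (y - 1)) ≤ X.sum := by
    have := Multiset.neg_mul_card_le_sum fun a ha => (hX a ha).1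
    nlinarith
  have hMM : 2 * ((M : ℤ) * (M - 1)) ≤ M * ((M : ℤ) ^ 2 - 1) := by
    nlinarith [mul_nonneg (by linarith : (0 : ℤ) ≤ M) (sq_nonneg ((M : ℤ) - 1))]
  have hMy : (M : ℤ) * (y - 1) ≤ M * (M - 1) := by nlinarith
  have hM0 : (0 : ℤ) ≤ M * (M - 1) := by nlinarith
  -- All of `X` is reserved here, so the remainder stays nonnegative whichever part of `X` is used.
  let P : ℕ → Prop := fun k => ∃ T ≤ R, (y : ℤ) ∣ T.sum ∧ 0 ≤ u + X.sum + T.sum ∧ T.card = k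
  have hP0 : P 0 := ⟨0, by simp, by simp, by simp; linarith, rfl⟩
  classical
  obtain ⟨T, hTR, hTd, hT0, hTk⟩ := Nat.findGreatest_spec (P := P) (Nat.zero_le R.card) hP0
  obtain ⟨S, rfl⟩ := Multiset.le_iff_exists_add.1 hTR
  -- Otherwise `y` unused terms would contain a nonempty block with sum divisible by `y` and at
  -- least `-M * y`, contradicting the maximality of `T`.
  have hgap : S.card < y ∨ u + X.sum + T.sum < M * y := by
    by_contra! hcon
    obtain ⟨T', hT', hT'0, hT'c, hT'd⟩ := Multiset.exists_le_card_le_dvd_sum hy hcon.1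
    have hle : T + T' ≤ T + S := add_le_add_right hT' T
    have hs := Multiset.neg_mul_card_le_sum fun a ha =>
      (hR a (Multiset.mem_add.2 (Or.inr (Multiset.mem_of_le hT' ha)))).1
    have hcM : (M : ℤ) * T'.card ≤ M * y := by
      exact_mod_cast Nat.mul_le_mul_left M hT'c
    have hP : P (T + T').card := ⟨T + T', hle, by rw [Multiset.sum_add]; exact dvd_add hTd hT'd,
      by rw [Multiset.sum_add]; linarith [hcon.2], rfl⟩
    have h1 := Nat.le_findGreatest (P := P) (Multiset.card_le_card hle) hP
    rw [← hTk, Multiset.card_add] at h1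
    exact hT'0 (Multiset.card_eq_zero.1 (by omega))
  obtain ⟨X₀, hX₀, hd⟩ := hcov
  obtain ⟨X₁, rfl⟩ := Multiset.le_iff_exists_add.1 hX₀
  have hX₁ : X₁.sum ≤ 0 :=
    Multiset.sum_nonpos_of_forall_neg fun a ha => (hX a (Multiset.mem_add.2 (Or.inr ha))).2
  have hX₀n : X₀.sum ≤ 0 :=
    Multiset.sum_nonpos_of_forall_neg fun a ha => (hX a (Multiset.mem_add.2 (Or.inl ha))).2
  obtain ⟨k, hk⟩ := dvd_add hd hTd
  simp only [Multiset.sum_add, Multiset.sum_replicate, nsmul_eq_mul] at hXs hT0 hgap hsum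
  have hM2 : ((2 * M - 2 : ℕ) : ℤ) = 2 * M - 2 := by
    have : 1 ≤ M := hy.trans_le hyM
    omega
  rw [hM2] at hsum
  have hk0 : 0 ≤ k := by nlinarith
  -- If few terms are left over, `v` outweighs them and the unused part of `X`. Otherwise the
  -- remainder is below `M * y + M * (y - 1) ≤ (2 * M - 1) * y`.
  have hk1 : k ≤ 2 * M - 2 := by
    rcases hgap with h | h
    · have hs := Multiset.neg_mul_card_le_sum fun a ha =>
        (hR a (Multiset.mem_add.2 (Or.inr ha))).1
      have h' : (S.card : ℤ) + 1 ≤ y := by exact_mod_cast h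
      have hs' : -((M : ℤ) * (y - 1)) ≤ S.sum := by nlinarith
      have : (y : ℤ) * k ≤ y * (2 * M - 2) := by linarith
      exact le_of_mul_le_mul_left this (by linarith)
    · have : (y : ℤ) * k < y * (2 * M - 1) := by linarith
      have := lt_of_mul_lt_mul_left this (by linarith)
      omega
  lift k to ℕ using hk0
  refine ⟨X₀ + Multiset.replicate k (-(y : ℤ)) + T, ?_, ?_⟩
  · refine add_le_add (add_le_add (Multiset.le_add_right _ _) ?_) (Multiset.le_add_right _ _)
    exact (Multiset.replicate_le_replicate _).2 (by omega)
  · simp only [Multiset.sum_add, Multiset.sum_replicate, nsmul_eq_mul]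
    linarith

/-- Among `|x|` terms some nonempty block has sum `l • x` with `1 ≤ l ≤ M`. Disjoint blocks are
collected until the multiple first reaches `t + 1`, so it overshoots by at most `M - 1`. -/
theorem exists_le_sum_eq_nsmul {M : ℕ} {x : ℤ} (hx : -(M : ℤ) ≤ x ∧ x < 0) (t : ℕ)
    {N : Multiset ℤ} (hN : ∀ a ∈ N, -(M : ℤ) ≤ a ∧ a < 0) (hc : M * (t + 1) ≤ N.card) :
    ∃ T ≤ N, T.card ≤ M * (t + 1) ∧ ∃ l : ℕ, T.sum = l • x ∧ t + 1 ≤ l ∧ l ≤ t + M := by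
  have block : ∀ N : Multiset ℤ, (∀ a ∈ N, -(M : ℤ) ≤ a ∧ a < 0) → M ≤ N.card →
      ∃ T ≤ N, T.card ≤ M ∧ ∃ l : ℕ, T.sum = l • x ∧ 1 ≤ l ∧ l ≤ M := by
    intro N hN hc
    obtain ⟨T, hT, hT0, hTc, hTd⟩ := Multiset.exists_le_card_le_dvd_sum
      (n := x.natAbs) (by omega) (N := N) (by omega)
    have hTn : ∀ a ∈ T, -(M : ℤ) ≤ a ∧ a < 0 := fun a ha => hN a (Multiset.mem_of_le hT ha)
    obtain ⟨l, hl⟩ := Int.natAbs_dvd.1 hTd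
    have h1 := Multiset.neg_mul_card_le_sum fun a ha => (hTn a ha).1
    have h2 : T.sum < 0 := by
      obtain ⟨a, ha⟩ := Multiset.exists_mem_of_ne_zero hT0
      obtain ⟨T', rfl⟩ := Multiset.exists_cons_of_mem ha
      have := Multiset.sum_nonpos_of_forall_neg fun b hb => (hTn b (Multiset.mem_cons_of_mem hb)).2
      rw [Multiset.sum_cons]
      linarith [(hTn a ha).2]
    have h3 : (T.card : ℤ) ≤ -x := by omega
    have hl0 : 0 < l := by
      by_contra! h
      nlinarith [mul_nonneg_of_nonpos_of_nonpos hx.2.le h]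
    have hlM : l ≤ M := by
      have : (-x) * l ≤ (-x) * M := by nlinarith [mul_le_mul_of_nonneg_left h3 (Nat.cast_nonneg M : (0:ℤ) ≤ M)]
      exact le_of_mul_le_mul_left this (by linarith)
    lift l to ℕ using hl0.le
    exact ⟨T, hT, by omega, l, by rw [hl, nsmul_eq_mul, mul_comm], by omega, by omega⟩
  induction t with
  | zero => simpa using block N hN (by simpa using hc)
  | succ t ih =>
    obtain ⟨T, hT, hTc, l, hl, h1, h2⟩ := ih ((Nat.mul_le_mul_left M (by omega)).trans hc)
    by_cases hlt : t + 2 ≤ l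
    · exact ⟨T, hT, hTc.trans (Nat.mul_le_mul_left M (by omega)), l, hl, hlt, by omega⟩
    obtain ⟨S, rfl⟩ := Multiset.le_iff_exists_add.1 hT
    have e : M * (t + 1 + 1) = M * (t + 1) + M := by ring
    rw [Multiset.card_add] at hc
    obtain ⟨T', hT', hTc', l', hl', h1', h2'⟩ := block S
      (fun a ha => hN a (Multiset.mem_add.2 (Or.inr ha))) (by omega)
    refine ⟨T + T', add_le_add_right hT' T, by rw [Multiset.card_add]; omega, l + l', ?_, ?_, ?_⟩
    · rw [Multiset.sum_add, hl, hl', add_nsmul]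
    · omega
    · omega

/-- Provides disjoint subsequences `T x` of `N` that can be traded for `l x` copies of `x` without
changing any sum. Each `x` consumes at most `M * t x` terms. -/
theorem exists_exchange {M : ℕ} (D : Finset ℤ) (hD : ∀ x ∈ D, -(M : ℤ) ≤ x ∧ x < 0)
    (t : ℤ → ℕ) (ht : ∀ x ∈ D, 1 ≤ t x) {N : Multiset ℤ}
    (hN : ∀ a ∈ N, -(M : ℤ) ≤ a ∧ a < 0) (hc : M * ∑ x ∈ D, t x ≤ N.card) :
    ∃ (T : ℤ → Multiset ℤ) (l : ℤ → ℕ), ∑ x ∈ D, T x ≤ N ∧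
      ∀ x ∈ D, (T x).sum = l x • x ∧ t x ≤ l x ∧ l x + 1 ≤ t x + M := by
  classical
  induction D using Finset.induction_on generalizing N with
  | empty => exact ⟨fun _ => 0, fun _ => 0, by simp, by simp⟩
  | insert x D hx ih =>
    rw [Finset.sum_insert hx, mul_add] at hc
    obtain ⟨s, hs⟩ : ∃ s, t x = s + 1 := ⟨t x - 1, by have := ht x (by simp); omega⟩
    obtain ⟨T₁, hT₁, hT₁c, l₁, hl₁, h1, h2⟩ := exists_le_sum_eq_nsmul (hD x (by simp)) s hN
      (by rw [← hs]; omega)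
    obtain ⟨S, rfl⟩ := Multiset.le_iff_exists_add.1 hT₁
    rw [Multiset.card_add] at hc
    rw [← hs] at hT₁c
    obtain ⟨T, l, hT, hl⟩ := ih (fun w hw => hD w (by simp [hw])) (fun w hw => ht w (by simp [hw]))
      (N := S) (fun a ha => hN a (Multiset.mem_add.2 (Or.inr ha))) (by omega)
    have hne : ∀ w ∈ D, w ≠ x := fun w hw h => hx (h ▸ hw)
    refine ⟨Function.update T x T₁, Function.update l x l₁, ?_, ?_⟩
    · rw [Finset.sum_insert hx, Function.update_self,
        Finset.sum_congr rfl fun w hw => Function.update_of_ne (hne w hw) _ _]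
      exact add_le_add_right hT T₁
    · intro w hw
      rcases Finset.mem_insert.1 hw with rfl | hw
      · simp only [Function.update_self]
        exact ⟨hl₁, by omega, by omega⟩
      · simp only [Function.update_of_ne (hne w hw)]
        exact hl w hw

/-! ### Positive and negative terms -/

theorem posTerms_add (S T : Multiset ℤ) : posTerms (S + T) = posTerms S + posTerms T :=
  Multiset.filter_add _ _ _

theorem mem_posTerms {S : Multiset ℤ} {x : ℤ} : x ∈ posTerms S ↔ x ∈ S ∧ 0 < x :=
  Multiset.mem_filter

theorem mem_negTerms {S : Multiset ℤ} {x : ℤ} : x ∈ negTerms S ↔ x ∈ S ∧ x < 0 :=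
  Multiset.mem_filter

theorem posTerms_add_negTerms {S : Multiset ℤ} (h : (0 : ℤ) ∉ S) :
    posTerms S + negTerms S = S := by
  have : negTerms S = S.filter fun x => ¬ 0 < x :=
    Multiset.filter_congr fun x hx => by
      have : x ≠ 0 := fun e => h (e ▸ hx)
      omega
  rw [this, posTerms, Multiset.filter_add_not]

theorem exists_pos_of_sum_eq_zero {S : Multiset ℤ} (h0 : (0 : ℤ) ∉ S) (hS : S.sum = 0)
    (hne : S ≠ 0) : ∃ x ∈ S, 0 < x := by
  by_contra! h
  obtain ⟨a, ha⟩ := Multiset.exists_mem_of_ne_zero hne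
  obtain ⟨T, rfl⟩ := Multiset.exists_cons_of_mem ha
  have hneg : ∀ b ∈ a ::ₘ T, b < 0 := fun b hb =>
    lt_of_le_of_ne (h b hb) fun e => h0 (e ▸ hb)
  have := Multiset.sum_nonpos_of_forall_neg fun b hb => hneg b (Multiset.mem_cons_of_mem hb)
  rw [Multiset.sum_cons] at hS
  linarith [hneg a ha]

theorem card_posTerms_pos {S : Multiset ℤ} (h0 : (0 : ℤ) ∉ S) (hS : S.sum = 0)
    (hne : S ≠ 0) : 0 < (posTerms S).card := by
  obtain ⟨x, hx, hx0⟩ := exists_pos_of_sum_eq_zero h0 hS hne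
  exact Multiset.card_pos_iff_exists_mem.2 ⟨x, mem_posTerms.2 ⟨hx, hx0⟩⟩

/-! ### At most `M` positive terms in an atom with terms at least `-M` -/

/-- While the sum is positive, a negative term remains outside `T`; appending it lowers the sum by
at most `M`, so the sum stays above `-M`. -/
theorem exists_le_sum_mem_Ioc {M : ℤ} {S : Multiset ℤ} (hS : S.sum = 0)
    (hM : ∀ x ∈ S, -M ≤ x) {T : Multiset ℤ} (hT : T ≤ S) (hTs : -M < T.sum) :
    ∃ T', T ≤ T' ∧ T' ≤ S ∧ posTerms T' = posTerms T ∧ -M < T'.sum ∧ T'.sum ≤ 0 := by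
  obtain ⟨R, rfl⟩ := Multiset.le_iff_exists_add.1 hT
  induction hn : R.card generalizing T R with
  | zero =>
    rw [Multiset.card_eq_zero.1 hn, add_zero] at hS
    exact ⟨T, le_rfl, hT, rfl, hTs, hS.le⟩
  | succ n ih =>
    by_cases h0 : T.sum ≤ 0
    · exact ⟨T, le_rfl, hT, rfl, hTs, h0⟩
    obtain ⟨b, hb, hb0⟩ : ∃ b ∈ R, b < 0 := by
      by_contra! h
      have := Multiset.sum_nonneg h
      rw [Multiset.sum_add] at hS
      omega
    obtain ⟨R', rfl⟩ := Multiset.exists_cons_of_mem hb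
    have e : T + b ::ₘ R' = (b ::ₘ T) + R' := by simp
    have hbM := hM b (by simp)
    rw [e] at hS hM ⊢
    obtain ⟨T', h1, h2, h3, h4, h5⟩ := ih (T := b ::ₘ T) (R := R')
      (by rw [Multiset.sum_cons]; omega) hS hM (Multiset.le_add_right _ _) (by simpa using hn)
    refine ⟨T', (Multiset.le_cons_self _ _).trans h1, h2, ?_, h4, h5⟩
    rw [h3, posTerms, Multiset.filter_cons_of_neg _ (by omega), posTerms]

/-- Build an increasing chain, adding one positive term at a time and then negative terms until the
sum lies in `(-M, 0]`. Two of the first `M + 1` sums coincide, and the difference is a zero-sum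
subsequence with at most `M` positive terms, hence proper. -/
theorem exists_le_sum_eq_zero_of_lt_card_posTerms {M : ℕ} (hM0 : 0 < M) {S : Multiset ℤ}
    (hS : S.sum = 0) (hM : ∀ x ∈ S, -(M : ℤ) ≤ x) (hc : M < (posTerms S).card) :
    ∃ T ≤ S, T.sum = 0 ∧ T ≠ 0 ∧ T ≠ S := by
  let Good := {T : Multiset ℤ // T ≤ S ∧ -(M : ℤ) < T.sum ∧ T.sum ≤ 0}
  have step : ∀ T : Good, ∃ T' : Good, T.1 ≤ T'.1 ∧
      ((posTerms T.1).card < (posTerms S).card →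
        (posTerms T'.1).card = (posTerms T.1).card + 1) := by
    rintro ⟨T, hT, h1, h2⟩
    by_cases hlt : (posTerms T).card < (posTerms S).card
    · obtain ⟨R, rfl⟩ := Multiset.le_iff_exists_add.1 hT
      rw [posTerms_add, Multiset.card_add] at hlt
      obtain ⟨a, ha⟩ := Multiset.card_pos_iff_exists_mem.1 (by omega : 0 < (posTerms R).card)
      obtain ⟨haR, ha0⟩ := mem_posTerms.1 ha
      obtain ⟨T', h1', h2', h3', h4', h5'⟩ := exists_le_sum_mem_Ioc hS hM (T := a ::ₘ T)
        (by
          rw [← Multiset.singleton_add, add_comm]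
          exact add_le_add_right (Multiset.singleton_le.2 haR) T)
        (by rw [Multiset.sum_cons]; omega)
      refine ⟨⟨T', h2', h4', h5'⟩, (Multiset.le_cons_self _ _).trans h1', fun _ => ?_⟩
      rw [h3', posTerms, Multiset.filter_cons_of_pos _ ha0, Multiset.card_cons, posTerms]
    · exact ⟨⟨T, hT, h1, h2⟩, le_rfl, fun h => absurd h hlt⟩
  choose g hg1 hg2 using step
  let T₀ : Good := ⟨0, Multiset.zero_le _, by simpa using hM0, by simp⟩
  let f : ℕ → Good := fun n => g^[n] T₀
  have hf : ∀ n, f (n + 1) = g (f n) := fun n => Function.iterate_succ_apply' _ _ _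
  have hmono : Monotone fun n => (f n).1 := monotone_nat_of_le_succ fun n => by
    simp only [hf]; exact hg1 _
  have hcard : ∀ n ≤ M, (posTerms (f n).1).card = n := by
    intro n
    induction n with
    | zero => intro _; rfl
    | succ n ih =>
      intro hn
      have hi := ih (by omega)
      rw [hf, hg2 _ (by omega), hi]
  have key : ∃ i j : ℕ, i < j ∧ j ≤ M ∧ (f i).1.sum = (f j).1.sum := by
    have hlt : (Finset.Ioc (-(M : ℤ)) 0).card < (Finset.range (M + 1)).card := by simp
    obtain ⟨i, hi, j, hj, hij, he⟩ := Finset.exists_ne_map_eq_of_card_lt_of_maps_to hlt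
      (f := fun i => (f i).1.sum) (fun i _ => by simpa using (f i).2.2)
    rw [Finset.mem_range] at hi hj
    rcases lt_or_gt_of_ne hij with h | h
    · exact ⟨i, j, h, by omega, he⟩
    · exact ⟨j, i, h, by omega, he.symm⟩
  obtain ⟨i, j, hij, hj, he⟩ := key
  obtain ⟨T, hT⟩ := Multiset.le_iff_exists_add.1 (hmono hij.le)
  have hTc : (posTerms T).card = j - i := by
    have := hcard j hj
    have h2 := hcard i (by omega)
    simp only at hT
    rw [hT, posTerms_add, Multiset.card_add] at this
    omega
  refine ⟨T, le_trans ?_ (f j).2.1, ?_, ?_, ?_⟩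
  · simp only at hT; rw [hT]; exact Multiset.le_add_left _ _
  · simp only at hT
    rw [hT, Multiset.sum_add] at he
    omega
  · rintro rfl
    simp [posTerms] at hTc
    omega
  · rintro rfl
    omega

/-! ### Factorizations in the monoid of zero-sum sequences -/

section

variable {G₀ : Set ℤ}

theorem zeroSumMonoid.isAddUnit_iff {a : zeroSumMonoid G₀} : IsAddUnit a ↔ a = 0 := by
  refine ⟨?_, fun h => h ▸ isAddUnit_zero⟩
  rintro ⟨u, rfl⟩
  have h := congrArg Subtype.val u.val_neg
  exact Subtype.ext (add_eq_zero.1 h).1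

theorem zeroSumMonoid.coe_sum (z : Multiset (zeroSumMonoid G₀)) :
    z.sum.1 = (z.map Subtype.val).sum :=
  map_multiset_sum (zeroSumMonoid G₀).subtype z

theorem zeroSumMonoid.exists_factorization (a : zeroSumMonoid G₀) :
    (factorizations a).Nonempty := by
  induction hn : a.1.card using Nat.strong_induction_on generalizing a with
  | _ n ih =>
  by_cases h0 : a = 0
  · exact ⟨0, by simp, by simp [h0]⟩
  by_cases hi : AddIrreducible a
  · exact ⟨{a}, by simpa using hi, by simp⟩
  rw [addIrreducible_iff] at hi
  simp only [zeroSumMonoid.isAddUnit_iff, h0, not_false_eq_true, true_and] at hi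
  push Not at hi
  obtain ⟨b, c, rfl, hb, hc⟩ := hi
  have hb' : 0 < b.1.card := Multiset.card_pos.2 fun h => hb (Subtype.ext h)
  have hc' : 0 < c.1.card := Multiset.card_pos.2 fun h => hc (Subtype.ext h)
  have hbc : b.1.card + c.1.card = n := by rw [← hn, ← Multiset.card_add]; rfl
  obtain ⟨z, hz, hz'⟩ := ih b.1.card (by omega) b rfl
  obtain ⟨w, hw, hw'⟩ := ih c.1.card (by omega) c rfl
  refine ⟨z + w, fun u hu => ?_, by rw [Multiset.sum_add, hz', hw']⟩
  rcases Multiset.mem_add.1 hu with h | h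
  · exact hz u h
  · exact hw u h

theorem zeroSumMonoid.exists_factorization_sum (P : Multiset (zeroSumMonoid G₀))
    (hP : 0 ∉ P) : ∃ z ∈ factorizations P.sum, P.card ≤ z.card := by
  induction P using Multiset.induction with
  | empty => exact ⟨0, by simp [factorizations], le_rfl⟩
  | cons a P ih =>
    rw [Multiset.mem_cons, not_or] at hP
    obtain ⟨z, ⟨hz, hz'⟩, hzc⟩ := ih hP.2
    obtain ⟨w, hw, hw'⟩ := zeroSumMonoid.exists_factorization a
    have hw0 : 0 < w.card := Multiset.card_pos.2 fun h => hP.1 (by rw [← hw', h]; rfl)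
    refine ⟨w + z, ⟨fun u hu => ?_, by rw [Multiset.sum_add, hz', hw', Multiset.sum_cons]⟩, ?_⟩
    · rcases Multiset.mem_add.1 hu with h | h
      · exact hw u h
      · exact hz u h
    · rw [Multiset.card_add, Multiset.card_cons]
      omega

theorem zeroSumMonoid.zero_notMem (hG₀ : (0 : ℤ) ∉ G₀) (a : zeroSumMonoid G₀) :
    (0 : ℤ) ∉ a.1 := fun h => hG₀ (a.2.1 0 h)

theorem zeroSumMonoid.card_le_card_posTerms_sum (hG₀ : (0 : ℤ) ∉ G₀)
    {z : Multiset (zeroSumMonoid G₀)} (hz : 0 ∉ z) : z.card ≤ (posTerms z.sum.1).card := by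
  induction z using Multiset.induction with
  | empty => simp
  | cons a z ih =>
    rw [Multiset.mem_cons, not_or] at hz
    have h1 := ih hz.2
    have h2 := card_posTerms_pos (zeroSumMonoid.zero_notMem hG₀ a) a.2.2
      fun h => hz.1 (Subtype.ext h.symm)
    rw [Multiset.sum_cons, Multiset.card_cons, AddSubmonoid.coe_add, posTerms_add,
      Multiset.card_add]
    omega

theorem zeroSumMonoid.card_posTerms_sum_le {k : ℕ} {z : Multiset (zeroSumMonoid G₀)}
    (hz : ∀ a ∈ z, (posTerms a.1).card ≤ k) : (posTerms z.sum.1).card ≤ k * z.card := by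
  induction z using Multiset.induction with
  | empty => simp [posTerms]
  | cons a z ih =>
    have h1 := ih fun b hb => hz b (Multiset.mem_cons_of_mem hb)
    have h2 := hz a (Multiset.mem_cons_self _ _)
    rw [Multiset.sum_cons, Multiset.card_cons, AddSubmonoid.coe_add, posTerms_add,
      Multiset.card_add, mul_add]
    omega

theorem factorizations_ne_zero {a : zeroSumMonoid G₀} {z : Multiset (zeroSumMonoid G₀)}
    (hz : z ∈ factorizations a) : 0 ∉ z := fun h =>
  (hz.1 0 h).not_isAddUnit isAddUnit_zero

theorem card_posTerms_le_of_addIrreducible {M : ℕ} (hM0 : 0 < M) {U : zeroSumMonoid G₀}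
    (hU : AddIrreducible U) (hM : ∀ x ∈ U.1, -(M : ℤ) ≤ x) : (posTerms U.1).card ≤ M := by
  by_contra! hc
  obtain ⟨T, hT, hT0, hTne, hTne'⟩ :=
    exists_le_sum_eq_zero_of_lt_card_posTerms hM0 U.2.2 hM hc
  obtain ⟨S, hS⟩ := Multiset.le_iff_exists_add.1 hT
  have hmem : ∀ g ∈ T + S, g ∈ G₀ := hS ▸ U.2.1
  have hS0 : S.sum = 0 := by
    have := U.2.2
    rwa [hS, Multiset.sum_add, hT0, zero_add] at this
  have := hU.isAddUnit_or_isAddUnit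
    (a := ⟨T, fun g hg => hmem g (Multiset.mem_add.2 (Or.inl hg)), hT0⟩)
    (b := ⟨S, fun g hg => hmem g (Multiset.mem_add.2 (Or.inr hg)), hS0⟩) (Subtype.ext hS)
  rw [zeroSumMonoid.isAddUnit_iff, zeroSumMonoid.isAddUnit_iff] at this
  rcases this with h | h
  · exact hTne (congrArg Subtype.val h)
  · have : S = 0 := congrArg Subtype.val h
    rw [this, add_zero] at hS
    exact hTne' hS.symm

theorem factorizationDist_add_left_le {H : Type*} [DecidableEq H]
    (K R R' : Multiset H) : factorizationDist (K + R) (K + R') ≤ max R.card R'.card := by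
  have h : K ≤ (K + R) ∩ (K + R') :=
    Multiset.le_inter (Multiset.le_add_right _ _) (Multiset.le_add_right _ _)
  refine max_le_max ?_ ?_
  · refine Multiset.card_le_card ((tsub_le_tsub_left h _).trans ?_)
    rw [add_tsub_cancel_left]
  · refine Multiset.card_le_card ((tsub_le_tsub_left h _).trans ?_)
    rw [add_tsub_cancel_left]

/-- Replacing the atoms `R` of a factorization by more than `|R|` nonempty zero-sum sequences
with the same product yields a longer factorization nearby. -/
theorem exists_longer_of_refinement (hG₀ : (0 : ℤ) ∉ G₀) {B : zeroSumMonoid G₀}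
    {z R : Multiset (zeroSumMonoid G₀)} (hz : z ∈ factorizations B) (hR : R ≤ z) {d : ℕ}
    (hRd : R.card ≤ d) (hpos : (posTerms R.sum.1).card ≤ d) {P : Multiset (Multiset ℤ)}
    (hP : P.sum = R.sum.1) (hP0 : ∀ T ∈ P, T.sum = 0 ∧ T ≠ 0) (hc : R.card < P.card) :
    ∃ z' ∈ factorizations B, z.card < z'.card ∧ factorizationDist z z' ≤ d := by
  have hmem : ∀ T ∈ P, T ∈ zeroSumMonoid G₀ := fun T hT =>
    ⟨fun g hg => R.sum.2.1 g (hP ▸ Multiset.mem_of_le (Multiset.le_sum_of_mem hT) hg),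
      (hP0 T hT).1⟩
  lift P to Multiset (zeroSumMonoid G₀) using hmem
  have hPs : P.sum = R.sum := Subtype.ext (by rw [zeroSumMonoid.coe_sum, hP])
  have hP0' : 0 ∉ P := fun h => (hP0 _ (Multiset.mem_map_of_mem _ h)).2 rfl
  obtain ⟨w, hw, hwc⟩ := zeroSumMonoid.exists_factorization_sum P hP0'
  obtain ⟨K, rfl⟩ := Multiset.le_iff_exists_add.1 hR
  rw [Multiset.card_map] at hc
  -- Each new atom uses up a positive term, so there are at most `d` of them.
  have hwp := zeroSumMonoid.card_le_card_posTerms_sum hG₀ (factorizations_ne_zero hw)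
  rw [hw.2, hPs] at hwp
  refine ⟨K + w, ⟨fun u hu => ?_, ?_⟩, ?_, ?_⟩
  · rcases Multiset.mem_add.1 hu with h | h
    · exact hz.1 u (Multiset.mem_add.2 (Or.inr h))
    · exact hw.1 u h
  · rw [Multiset.sum_add, hw.2, hPs, ← hz.2, Multiset.sum_add, add_comm]
  · simp only [Multiset.card_add]; omega
  · rw [add_comm R K]
    exact (factorizationDist_add_left_le K R w).trans (max_le hRd (hwp.trans hpos))

end

/-! ### Lengthening factorizations -/

section

variable {G₀ : Set ℤ}

theorem Multiset.exists_le_count_of_card {M k : ℕ} {N : Multiset ℤ}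
    (hN : ∀ a ∈ N, -(M : ℤ) ≤ a ∧ a < 0) (hc : M * k < N.card) :
    ∃ y : ℕ, 0 < y ∧ y ≤ M ∧ k + 1 ≤ N.count (-(y : ℤ)) := by
  have hsub : ∀ a ∈ N, a ∈ Finset.Ico (-(M : ℤ)) 0 := fun a ha => Finset.mem_Ico.2 (hN a ha)
  obtain ⟨y, hy, hlt⟩ : ∃ y ∈ Finset.Ico (-(M : ℤ)) 0, k < N.count y := by
    by_contra! h
    have := Finset.sum_le_card_nsmul _ _ _ h
    rw [Multiset.sum_count_eq_card hsub] at this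
    simp at this
    omega
  rw [Finset.mem_Ico] at hy
  refine ⟨y.natAbs, by omega, by omega, ?_⟩
  have : -((y.natAbs : ℕ) : ℤ) = y := by omega
  rw [this]
  exact hlt

/-- An atom `U` with at least two positive terms, together with at most `M - 1` further atoms
of the factorization, can be refined into more zero-sum sequences, provided a positive term of `U`
lies in the group generated by negative terms of high multiplicity. -/
theorem exists_refinement {M : ℕ} (hM : 2 ≤ M) (hG₀ : (0 : ℤ) ∉ G₀)
    {z : Multiset (zeroSumMonoid G₀)} (hzM : ∀ V ∈ z, ∀ x ∈ V.1, -(M : ℤ) ≤ x)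
    {U : zeroSumMonoid G₀} (hU : U ∈ z) (h2 : 2 ≤ (posTerms U.1).card)
    (hUp : ∀ x ∈ posTerms U.1, (M : ℤ) * ((M : ℤ) ^ 2 - 1) ≤ x)
    {A : Set ℤ} (hA : ∀ x ∈ A, x < 0 ∧ ∃ V ∈ z, 2 * M - 1 ≤ V.1.count x)
    (hUA : ∀ x ∈ posTerms U.1, x ∈ AddSubgroup.closure A) :
    ∃ R ≤ z, R.card ≤ M ∧ ∃ P : Multiset (Multiset ℤ), P.sum = R.sum.1 ∧
      (∀ T ∈ P, T.sum = 0 ∧ T ≠ 0) ∧ R.card < P.card := by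
  classical
  have hsplit := posTerms_add_negTerms (zeroSumMonoid.zero_notMem hG₀ U)
  have hUs := U.2.2
  obtain ⟨u, hu⟩ := Multiset.card_pos_iff_exists_mem.1 (by omega : 0 < (posTerms U.1).card)
  have huA := hUA u hu
  have huM := hUp u hu
  have hu0 := (mem_posTerms.1 hu).2
  obtain ⟨V, hV⟩ := Multiset.exists_cons_of_mem hu
  have hVpos : ∀ a ∈ V, 0 < a := fun a ha =>
    (mem_posTerms.1 (hV ▸ Multiset.mem_cons_of_mem ha : a ∈ posTerms U.1)).2
  have hVs : (M : ℤ) * ((M : ℤ) ^ 2 - 1) ≤ V.sum := by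
    obtain ⟨v, hv⟩ := Multiset.card_pos_iff_exists_mem.1 (by
      rw [hV, Multiset.card_cons] at h2; omega : 0 < V.card)
    have h1 := hUp v (hV ▸ Multiset.mem_cons_of_mem hv)
    exact h1.trans (Multiset.single_le_sum (fun a ha => (hVpos a ha).le) v hv)
  set N := negTerms U.1
  have hN : ∀ a ∈ N, -(M : ℤ) ≤ a ∧ a < 0 := fun a ha =>
    ⟨hzM U hU a (mem_negTerms.1 ha).1, (mem_negTerms.1 ha).2⟩
  have hcountN : ∀ x < 0, N.count x = U.1.count x := fun x hx =>
    Multiset.count_filter_of_pos hx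
  have hNs : N.sum = -(u + V.sum) := by
    rw [← hsplit, hV, Multiset.sum_add, Multiset.sum_cons] at hUs
    linarith
  have hNc : 2 * (M ^ 2 - 1) ≤ N.card := by
    have h1 := Multiset.neg_mul_card_le_sum fun a ha => (hN a ha).1
    have h2 : (M : ℤ) * (2 * ((M : ℤ) ^ 2 - 1)) ≤ M * N.card := by linarith
    have h3 := le_of_mul_le_mul_left h2 (by omega)
    have h4 : ((M ^ 2 - 1 : ℕ) : ℤ) = (M : ℤ) ^ 2 - 1 := by
      rw [Nat.cast_sub (Nat.one_le_pow _ _ (by omega))]; simp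
    zify
    rw [h4]
    exact h3
  obtain ⟨k, rfl⟩ : ∃ k, M = k + 2 := ⟨M - 2, by omega⟩
  have hNc' : 2 * (k + 2) * (k + 1) + (2 * k + 2) ≤ N.card := by
    refine le_trans (le_of_eq ?_) hNc
    rw [show (k + 2) ^ 2 = (k ^ 2 + 4 * k + 3) + 1 by ring, Nat.add_sub_cancel]
    ring
  -- Here `M = k + 2`, so `-y` occurs at least `2 * k + 2 = 2 * M - 2` times.
  obtain ⟨y, hy, hyM, hyc⟩ := Multiset.exists_le_count_of_card (k := 2 * k + 1) hN
    (by nlinarith)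
  obtain ⟨X, hXA, hXc, hXcov⟩ := exists_multiset_subsums_cover hy A
  obtain ⟨X₀, hX₀, hX₀d⟩ := hXcov (-u) (neg_mem huA)
  have hcov : ∃ T ≤ X, (y : ℤ) ∣ u + T.sum := ⟨X₀, hX₀, by
    have := (dvd_neg (a := (y : ℤ))).2 hX₀d
    rwa [show -(-u - X₀.sum) = u + X₀.sum by ring] at this⟩
  have hXW : ∀ x ∈ X, x < 0 ∧ ∃ V ∈ z, 2 * (k + 2) - 1 ≤ V.1.count x := fun x hx =>
    hA x (hXA x hx).1
  have hX : ∀ a ∈ X, -((k + 2 : ℕ) : ℤ) ≤ a ∧ a < 0 := by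
    intro a ha
    obtain ⟨h, V, hVz, hc⟩ := hXW a ha
    exact ⟨hzM V hVz a (Multiset.count_pos.1 (by omega)), h⟩
  -- Keeps the copies of `-y` and the terms of `X` from competing for the same terms of `U`.
  have hyX : -(y : ℤ) ∉ X := fun h => (hXA _ h).2 ((dvd_neg).2 dvd_rfl)
  -- the terms of `X` of which `U` itself has too few
  set D : Finset ℤ := X.toFinset.filter fun x => U.1.count x < X.count x
  have hDX : ∀ x ∈ D, x ∈ X := fun x hx => Multiset.mem_toFinset.1 (Finset.mem_filter.1 hx).1
  -- `W x` is the atom from which `x` is borrowed; outside `D` its value is irrelevant.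
  have hWex : ∀ x : ℤ, ∃ w : zeroSumMonoid G₀, x ∈ D → w ∈ z ∧ 2 * (k + 2) - 1 ≤ w.1.count x := by
    intro x
    by_cases hx : x ∈ D
    · obtain ⟨-, w, hw⟩ := hXW x (hDX x hx)
      exact ⟨w, fun _ => hw⟩
    · exact ⟨0, fun h => absurd h hx⟩
  choose W hW using hWex
  set XU := X.filter fun x => x ∉ D with hXU
  set XD := X.filter fun x => x ∈ D with hXD
  have hXsplit : XD + XU = X := Multiset.filter_add_not _ _
  set Y := XU + Multiset.replicate (2 * (k + 2) - 2) (-(y : ℤ)) with hY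
  have hYN : Y ≤ N := by
    rw [Multiset.le_iff_count]
    intro x
    rw [hY, Multiset.count_add, Multiset.count_replicate]
    by_cases hxy : -(y : ℤ) = x
    · subst hxy
      rw [Multiset.count_eq_zero_of_notMem fun h => hyX (Multiset.mem_of_mem_filter h), if_pos rfl]
      omega
    · rw [if_neg hxy, add_zero]
      by_cases hx : x ∈ X ∧ x ∉ D
      · rw [hXU, Multiset.count_filter_of_pos (p := fun x => x ∉ D) hx.2, hcountN x (hX x hx.1).2]
        by_contra! h
        exact hx.2 (Finset.mem_filter.2 ⟨Multiset.mem_toFinset.2 hx.1, h⟩)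
      · rw [Multiset.count_eq_zero_of_notMem fun h => hx (Multiset.mem_filter.1 h)]
        exact Nat.zero_le _
  obtain ⟨N₁, hN₁⟩ := Multiset.le_iff_exists_add.1 hYN
  have hN₁neg : ∀ a ∈ N₁, -((k + 2 : ℕ) : ℤ) ≤ a ∧ a < 0 := fun a ha =>
    hN a (hN₁ ▸ Multiset.mem_add.2 (Or.inr ha))
  have hXDc : ∑ x ∈ D, X.count x = XD.card := by
    rw [← Multiset.sum_count_eq_card (s := D) (m := XD) fun a ha => (Multiset.mem_filter.1 ha).2]
    exact Finset.sum_congr rfl fun x hx => (Multiset.count_filter_of_pos hx).symm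
  have hXcard : XD.card + XU.card = X.card := by rw [← Multiset.card_add, hXsplit]
  -- After reserving the part of `X` found in `U` and the copies of `-y`, enough negative terms of
  -- `U` remain to pay for every exchange.
  have hN₁c : (k + 2) * ∑ x ∈ D, X.count x ≤ N₁.card := by
    have h1 : N.card = XU.card + (2 * k + 2) + N₁.card := by
      rw [hN₁, hY, Multiset.card_add, Multiset.card_add, Multiset.card_replicate]
      omega
    rw [hXDc]
    have h3 : (k + 2) * (XD.card + XU.card) ≤ (k + 2) * (k + 1) :=
      Nat.mul_le_mul_left _ (by omega)
    nlinarith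
  obtain ⟨T, l, hTN, hTl⟩ := exists_exchange D (fun x hx => hX x (hDX x hx)) (fun x => X.count x)
    (fun x hx => Multiset.count_pos.2 (hDX x hx)) hN₁neg hN₁c
  obtain ⟨N₂, hN₂⟩ := Multiset.le_iff_exists_add.1 hTN
  set F : Multiset ℤ := ∑ x ∈ D, Multiset.replicate (l x) x with hF
  have hcountF : ∀ (E : Finset ℤ) (a : ℤ),
      (∑ x ∈ E, Multiset.replicate (l x) x).count a = if a ∈ E then l a else 0 := by
    intro E a
    rw [Multiset.count_sum']
    simp [Multiset.count_replicate]
  have hXF : XD ≤ F := by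
    rw [Multiset.le_iff_count]
    intro x
    rw [hF, hcountF, hXD, Multiset.count_filter]
    split_ifs with hx
    · exact (hTl x hx).2.1
    · exact le_rfl
  obtain ⟨F', hF'⟩ := Multiset.le_iff_exists_add.1 hXF
  have hsumTF : ∀ E ⊆ D, (∑ x ∈ E, T x).sum = (∑ x ∈ E, Multiset.replicate (l x) x).sum := by
    intro E hE
    rw [Multiset.sum_sum, Multiset.sum_sum]
    refine Finset.sum_congr rfl fun x hx => ?_
    rw [(hTl x (hE hx)).1, Multiset.sum_replicate]
  have hFneg : ∀ a ∈ F, a ∈ X := by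
    intro a ha
    have := Multiset.count_pos.2 ha
    rw [hF, hcountF] at this
    split_ifs at this with h
    · exact hDX a h
    · omega
  -- `X + y^(2M-2) + (F' + N₂)` is the negative part of the modified atom
  obtain ⟨S, hS, hSu⟩ := exists_le_sum_eq_neg (R := F' + N₂) hy hyM hX
    (by
      intro a ha
      rcases Multiset.mem_add.1 ha with h | h
      · exact hX a (hFneg a (hF' ▸ Multiset.mem_add.2 (Or.inr h)))
      · exact hN₁neg a (hN₂ ▸ Multiset.mem_add.2 (Or.inr h)))
    hXc huM hVs hcov
    (by
      have h1 := hsumTF D subset_rfl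
      rw [← hNs, hN₁, hN₂, hY, ← hXsplit]
      rw [← hF, hF'] at h1
      simp only [Multiset.sum_add] at h1 ⊢
      linarith)
  obtain ⟨S', hS'⟩ := Multiset.le_iff_exists_add.1 hS
  set 𝒲 : Finset (zeroSumMonoid G₀) := D.image W
  let E : zeroSumMonoid G₀ → Finset ℤ := fun w => D.filter fun x => W x = w
  let F₀ : zeroSumMonoid G₀ → Multiset ℤ := fun w => ∑ x ∈ E w, Multiset.replicate (l x) x
  -- The loan fits: `l x ≤ X.count x + M - 1 ≤ 2 * M - 2`. One atom may lend several distinct `x`,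
  -- which does not affect the individual multiplicities.
  have hF₀le : ∀ w, F₀ w ≤ w.1 := by
    intro w
    rw [Multiset.le_iff_count]
    intro x
    simp only [F₀, hcountF]
    split_ifs with hx
    · obtain ⟨hxD, rfl⟩ := Finset.mem_filter.1 hx
      have h1 := (hW x hxD).2
      have h2 := (hTl x hxD).2.2
      have h3 := Multiset.count_le_card x X
      omega
    · exact Nat.zero_le _
  let G : zeroSumMonoid G₀ → Multiset ℤ := fun w => (w.1 - F₀ w) + ∑ x ∈ E w, T x
  have hGadd : ∀ w, G w + F₀ w = w.1 + ∑ x ∈ E w, T x := by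
    intro w
    simp only [G]
    rw [add_right_comm, tsub_add_cancel_of_le (hF₀le w)]
  have hGsum : ∑ w ∈ 𝒲, G w + F = ∑ w ∈ 𝒲, w.1 + ∑ x ∈ D, T x := by
    have hmaps : ∀ x ∈ D, W x ∈ 𝒲 := fun x hx => Finset.mem_image_of_mem _ hx
    rw [hF, ← Finset.sum_fiberwise_of_maps_to hmaps (fun x => Multiset.replicate (l x) x),
      ← Finset.sum_fiberwise_of_maps_to hmaps T, ← Finset.sum_add_distrib,
      ← Finset.sum_add_distrib]
    exact Finset.sum_congr rfl fun w _ => hGadd w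
  -- A lender has at least `2 * M - 1` copies of some `x` in `D`, whereas `U` has fewer than
  -- `X.count x ≤ M - 1`.
  have hU𝒲 : U ∉ 𝒲.val := by
    intro h
    obtain ⟨x, hx, hWx⟩ := Finset.mem_image.1 h
    have h1 := (hW x hx).2
    have h2 := (Finset.mem_filter.1 hx).2
    have h3 := Multiset.count_le_card x X
    rw [hWx] at h1
    omega
  have h𝒲c : 𝒲.card ≤ k + 1 := by
    have h1 : 𝒲.card ≤ D.card := Finset.card_image_le
    have h2 : D.card ≤ X.toFinset.card := Finset.card_filter_le _ _
    have h3 := Multiset.toFinset_card_le X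
    omega
  -- The modified `U` splits in two and each lender `w` becomes `G w`, a net gain of one.
  refine ⟨U ::ₘ 𝒲.val, ?_, ?_, (u ::ₘ S) ::ₘ (V + S') ::ₘ 𝒲.val.map G, ?_, ?_, ?_⟩
  · refine (Multiset.le_iff_subset (Multiset.nodup_cons.2 ⟨hU𝒲, 𝒲.nodup⟩)).2 fun w hw => ?_
    rcases Multiset.mem_cons.1 hw with rfl | hw
    · exact hU
    · obtain ⟨x, hx, rfl⟩ := Finset.mem_image.1 hw
      exact (hW x hx).1
  · rw [Multiset.card_cons, Finset.card_val]
    omega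
  · have hval : (𝒲.val.sum).1 = ∑ w ∈ 𝒲, w.1 := by
      rw [zeroSumMonoid.coe_sum]; rfl
    have hGval : (𝒲.val.map G).sum = ∑ w ∈ 𝒲, G w := rfl
    rw [Multiset.sum_cons, Multiset.sum_cons, hGval, Multiset.sum_cons, AddSubmonoid.coe_add, hval,
      ← hsplit, hV, hN₁, hN₂, hY]
    rw [← hXsplit] at hS'
    rw [hF'] at hGsum
    have h1 : S + S' + ∑ w ∈ 𝒲, G w =
        XU + Multiset.replicate (2 * (k + 2) - 2) (-(y : ℤ)) + N₂ +
          (∑ w ∈ 𝒲, G w + (XD + F')) := by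
      rw [← hS']; abel
    have h3 : ({u} + S) + ((V + S') + ∑ w ∈ 𝒲, G w) =
        {u} + V + (S + S' + ∑ w ∈ 𝒲, G w) := by abel
    rw [← Multiset.singleton_add, ← Multiset.singleton_add, h3, h1, hGsum]
    abel
  · intro Q hQ
    rcases Multiset.mem_cons.1 hQ with rfl | hQ
    · exact ⟨by rw [Multiset.sum_cons, hSu]; ring, Multiset.cons_ne_zero⟩
    rcases Multiset.mem_cons.1 hQ with rfl | hQ
    · constructor
      · have h1 := hsumTF D subset_rfl
        have h2 := congrArg Multiset.sum hS'
        rw [hN₁, hN₂, hY] at hNs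
        rw [← hXsplit] at h2
        rw [← hF, hF'] at h1
        simp only [Multiset.sum_add] at h1 h2 hNs ⊢
        linarith
      · intro h0
        rw [(add_eq_zero.1 h0).1] at hVs
        simp only [Multiset.sum_zero] at hVs
        push_cast at hVs
        nlinarith
    · obtain ⟨w, hw, rfl⟩ := Multiset.mem_map.1 hQ
      constructor
      · have h1 := congrArg Multiset.sum (hGadd w)
        have h2 := hsumTF (E w) (Finset.filter_subset _ _)
        rw [Multiset.sum_add, Multiset.sum_add w.1, w.2.2, h2] at h1
        linarith
      · obtain ⟨x, hx, rfl⟩ := Finset.mem_image.1 hw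
        intro h0
        have h1 : ∑ x' ∈ E (W x), T x' = 0 := (add_eq_zero.1 h0).2
        have h2 : T x = 0 :=
          Finset.sum_eq_zero_iff.1 h1 x (Finset.mem_filter.2 ⟨hx, rfl⟩)
        have h3 := (hTl x hx).1
        have h4 := (hTl x hx).2.1
        have h5 := Multiset.count_pos.2 (hDX x hx)
        have h6 := (hX x (hDX x hx)).2
        rw [h2, Multiset.sum_zero, eq_comm, nsmul_eq_mul, mul_eq_zero] at h3
        omega
  · simp

theorem exists_longer {M : ℕ} (hM : 2 ≤ M) (hG₀ : (0 : ℤ) ∉ G₀) {B : zeroSumMonoid G₀}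
    (hBM : ∀ x ∈ B.1, -(M : ℤ) ≤ x)
    (hBp : ∀ x ∈ posTerms B.1, (M : ℤ) * ((M : ℤ) ^ 2 - 1) ≤ x)
    {z : Multiset (zeroSumMonoid G₀)} (hz : z ∈ factorizations B)
    (hc : z.card < (posTerms B.1).card)
    {A : Set ℤ} (hA : ∀ x ∈ A, x < 0 ∧ ∃ V ∈ z, 2 * M - 1 ≤ V.1.count x)
    (hBA : ∀ x ∈ posTerms B.1, x ∈ AddSubgroup.closure A) :
    ∃ z' ∈ factorizations B, z.card < z'.card ∧ factorizationDist z z' ≤ M ^ 2 := by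
  have hle : ∀ V ∈ z, V.1 ≤ B.1 := fun V hV => by
    rw [← hz.2, zeroSumMonoid.coe_sum]
    exact Multiset.le_sum_of_mem (Multiset.mem_map_of_mem _ hV)
  have hposle : ∀ V ∈ z, ∀ x ∈ posTerms V.1, x ∈ posTerms B.1 := fun V hV x hx =>
    Multiset.mem_of_le (Multiset.filter_le_filter _ (hle V hV)) hx
  have hzM : ∀ V ∈ z, ∀ x ∈ V.1, -(M : ℤ) ≤ x := fun V hV x hx =>
    hBM x (Multiset.mem_of_le (hle V hV) hx)
  obtain ⟨U, hU, hU2⟩ : ∃ U ∈ z, 2 ≤ (posTerms U.1).card := by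
    by_contra! h
    have := zeroSumMonoid.card_posTerms_sum_le (k := 1) fun V hV => Nat.le_of_lt_succ (h V hV)
    rw [hz.2] at this
    omega
  obtain ⟨R, hR, hRc, P, hP, hP0, hPc⟩ := exists_refinement hM hG₀ hzM hU hU2
    (fun x hx => hBp x (hposle U hU x hx)) hA fun x hx => hBA x (hposle U hU x hx)
  refine exists_longer_of_refinement hG₀ hz hR (by nlinarith) ?_ hP hP0 hPc
  refine (zeroSumMonoid.card_posTerms_sum_le (k := M) fun V hV => ?_).trans (by nlinarith)
  have hVz := Multiset.mem_of_le hR hV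
  exact card_posTerms_le_of_addIrreducible (by omega) (hz.1 V hVz) (hzM V hVz)

/-- Iterating a step that lengthens factorizations yields a chain to maximal length. -/
theorem exists_chain_of_step {B : zeroSumMonoid G₀} {n d : ℕ}
    (hle : ∀ z ∈ factorizations B, z.card ≤ n)
    (step : ∀ z ∈ factorizations B, z.card < n →
      ∃ z' ∈ factorizations B, z.card < z'.card ∧ factorizationDist z z' ≤ d)
    (z : Multiset (zeroSumMonoid G₀)) (hz : z ∈ factorizations B) :
    ∃ (r : ℕ) (c : Fin (r + 1) → Multiset (zeroSumMonoid G₀)),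
      c 0 = z ∧ (∀ i, c i ∈ factorizations B) ∧ (c (Fin.last r)).card = n ∧
      ∀ i : Fin r, (c i.castSucc).card < (c i.succ).card ∧
        factorizationDist (c i.castSucc) (c i.succ) ≤ d := by
  induction hk : n - z.card using Nat.strong_induction_on generalizing z with
  | _ k ih =>
  have hzn := hle z hz
  by_cases hlt : z.card < n
  · obtain ⟨z', hz', hcard, hdist⟩ := step z hz hlt
    have := hle z' hz'
    obtain ⟨r, c, hc0, hcB, hcl, hcs⟩ := ih (n - z'.card) (by omega) z' hz' rfl
    refine ⟨r + 1, Fin.cons z c, rfl, ?_, ?_, ?_⟩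
    · intro i
      cases i using Fin.cases with
      | zero => exact hz
      | succ i => exact hcB i
    · rw [← Fin.succ_last, Fin.cons_succ]
      exact hcl
    · intro i
      cases i using Fin.cases with
      | zero =>
        rw [Fin.castSucc_zero, Fin.cons_zero, Fin.cons_succ, hc0]
        exact ⟨hcard, hdist⟩
      | succ i =>
        rw [← Fin.succ_castSucc, Fin.cons_succ, Fin.cons_succ]
        exact hcs i
  · exact ⟨0, fun _ => z, rfl, fun _ => hz, le_antisymm hzn (not_lt.1 hlt), fun i => i.elim0⟩

end

theorem mainTheorem12 (G₀ : Set ℤ) (hG₀ : (0 : ℤ) ∉ G₀) (hcond : IsCondensed G₀)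
    (hcard : 2 ≤ G₀.encard) (B : zeroSumMonoid G₀) (m p : ℤ) (M : ℕ)
    (hm : IsLeast {x : ℤ | x ∈ B.1} m) (hMm : M = m.natAbs) (hM : 2 ≤ M)
    (hp : IsLeast {x : ℤ | x ∈ posTerms B.1} p)
    (hpM : (M : ℤ) * ((M : ℤ) ^ 2 - 1) ≤ p) :
    (∃ A : Set ℤ, A ⊆ {x | x ∈ negTerms B.1} ∧ ∃ z ∈ factorizations B,
      ¬ AddSubgroup.closure {x | x ∈ posTerms B.1} ≤ AddSubgroup.closure A ∧
      AddSubgroup.closure A ≠ ⊤ ∧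
      ∀ U ∈ z, ∀ x ∈ B.1, x ∉ A → U.1.count x ≤ 2 * M - 2) ∨
    (IsGreatest (lengthSet B) (posTerms B.1).card ∧
      ∀ z ∈ factorizations B, ∃ (r : ℕ) (c : Fin (r + 1) → Multiset (zeroSumMonoid G₀)),
        c 0 = z ∧ (∀ i, c i ∈ factorizations B) ∧
        (c (Fin.last r)).card = (posTerms B.1).card ∧
        ∀ i : Fin r, (c i.castSucc).card < (c i.succ).card ∧
          factorizationDist (c i.castSucc) (c i.succ) ≤ M ^ 2) := by
  have hBM : ∀ x ∈ B.1, -(M : ℤ) ≤ x := fun x hx => by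
    have := hm.2 hx
    omega
  have hBp : ∀ x ∈ posTerms B.1, (M : ℤ) * ((M : ℤ) ^ 2 - 1) ≤ x := fun x hx =>
    hpM.trans (hp.2 hx)
  refine or_iff_not_imp_left.2 fun ha => ?_
  have hle : ∀ z ∈ factorizations B, z.card ≤ (posTerms B.1).card := fun z hz => by
    have := zeroSumMonoid.card_le_card_posTerms_sum hG₀ (factorizations_ne_zero hz)
    rwa [hz.2] at this
  have step : ∀ z ∈ factorizations B, z.card < (posTerms B.1).card →
      ∃ z' ∈ factorizations B, z.card < z'.card ∧ factorizationDist z z' ≤ M ^ 2 := by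
    intro z hz hc
    -- With this `A`, the multiplicity bound in (a) holds for `z`, so failure of (a) puts the
    -- positive terms of `B` in `⟨A⟩`.
    let A : Set ℤ := {x | x ∈ negTerms B.1 ∧ ∃ V ∈ z, 2 * M - 1 ≤ V.1.count x}
    refine exists_longer hM hG₀ hBM hBp hz hc (A := A)
      (fun x hx => ⟨(mem_negTerms.1 hx.1).2, hx.2⟩) ?_
    by_contra hnot
    have hnot' : ¬ AddSubgroup.closure {x | x ∈ posTerms B.1} ≤ AddSubgroup.closure A :=
      fun h => hnot fun x hx => h (AddSubgroup.subset_closure hx)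
    refine ha ⟨A, fun x hx => hx.1, z, hz, hnot', fun h => hnot' (h ▸ le_top), ?_⟩
    intro U hU x hx hxA
    by_cases hx0 : x < 0
    · by_contra! h
      exact hxA ⟨mem_negTerms.2 ⟨hx, hx0⟩, U, hU, by omega⟩
    · have hpos : 0 < x :=
        lt_of_le_of_ne (not_lt.1 hx0) fun e => zeroSumMonoid.zero_notMem hG₀ B (e ▸ hx)
      have hUB : U.1 ≤ B.1 := by
        rw [← hz.2, zeroSumMonoid.coe_sum]
        exact Multiset.le_sum_of_mem (Multiset.mem_map_of_mem _ hU)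
      have h1 := card_posTerms_le_of_addIrreducible (by omega) (hz.1 U hU)
        fun x hx => hBM x (Multiset.mem_of_le hUB hx)
      have h2 : (posTerms U.1).count x = U.1.count x := Multiset.count_filter_of_pos hpos
      have h3 := Multiset.count_le_card x (posTerms U.1)
      omega
  have chain := exists_chain_of_step hle step
  refine ⟨⟨?_, ?_⟩, chain⟩
  · obtain ⟨z, hz⟩ := zeroSumMonoid.exists_factorization B
    obtain ⟨r, c, -, hcB, hcl, -⟩ := chain z hz
    exact ⟨c (Fin.last r), hcB _, hcl⟩
  · rintro _ ⟨z, hz, rfl⟩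
    exact hle z hz
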